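/- Let $\mathcal{E}$ be a locally cartesian closed category with a terminal object $\mathbf 1$ and disjoint finite sums (initial object $\mathbf 0$). For $f\colon E\to B$ let $\Pi_f\colon\mathcal{E}/E\to\mathcal{E}/B$ be the right adjoint of pullback along $f$, and let the negation $\neg f\colon B\setminus\mathrm{im} f\to B$ be $\Pi_f(\mathbf 0\to E)$. A monomorphism $m\colon A\to X$, with negation $\neg m\colon \neg A\to X$, is decidable if the induced map $(m,\neg m)\colon A+\neg A\to X$ is invertible. Let $\mathbf{Poly}\,\mathcal{E}(1,1)$ be the category whose objects are polynomials $\mathbf 1\leftarrow E\xrightarrow{p}B\to\mathbf 1$ (that is, morphisms $p\colon E\to B$ of $\mathcal{E}$) and whose morphisms are cartesian maps (pullback squares). The product of $p\colon E\to B$ and $p'\colon E'\to B'$ is the polynomial $p\ast p'\colon E\times B'+E'\times B\to B\times B'$, and the linear polynomial $\mathbf 1$ is $\mathrm{id}\colon\mathbf 1\to\mathbf 1$; thus $p\ast\mathbf 1$ is isomorphic to $(p,\mathrm{id}_B)\colon E+B\to B$. The derivative of $p$ is the value at $p$ of the (possibly only partially defined) right adjoint to $(-)\ast\mathbf 1$;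 it exists if the functor $q\mapsto \mathbf{Poly}\,\mathcal{E}(1,1)(q\ast\mathbf 1,p)$ is representable, and is then a representing polynomial $Dp$. Proposition. Let $p\colon E\to B$ be a polynomial such that the diagonal $\delta_p\colon E\to E\times_B E$ is decidable, and write $\neg\delta_p\colon E\boxtimes_B E\to E\times_B E$ for its negation (so that the map $E+E\boxtimes_B E\to E\times_B E$ induced by $\delta_p$ and $\neg\delta_p$ is invertible). Then the derivative $Dp$ exists, and it is isomorphic to the polynomial $$\mathbf 1\longleftarrow E\boxtimes_B E\xrightarrow{\ \neg\delta_p\ }E\times_B E\xrightarrow{\ \pi_1\ }E\longrightarrow\mathbf 1,$$ whose middle map is $\pi_1\circ\neg\delta_p$. -/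

import Mathlib

open CategoryTheory CategoryTheory.Limits

universe v u

/-- A category with pullbacks is locally cartesian closed if for every morphism `f : E ⟶ B` the
pullback functor `Over B ⥤ Over E` has a right adjoint. -/
class IsLocallyCartesianClosed (C : Type u) [Category.{v} C] [HasPullbacks C] : Prop where
  isLeftAdjoint_pullback : ∀ {E B : C} (f : E ⟶ B), (Over.pullback f).IsLeftAdjoint

attribute [instance] IsLocallyCartesianClosed.isLeftAdjoint_pullback

namespace PolyDeriv

variable {C : Type u} [Category.{v} C]

section Negation

variable [HasPullbacks C] [IsLocallyCartesianClosed C]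

/-- The dependent product `Π_f : Over E ⥤ Over B`, right adjoint to pulling back along `f`. -/
noncomputable def depProd {E B : C} (f : E ⟶ B) : Over E ⥤ Over B :=
  (Over.pullback f).rightAdjoint

/-- The adjunction `Δ_f ⊣ Π_f`. -/
noncomputable def depProdAdj {E B : C} (f : E ⟶ B) : Over.pullback f ⊣ depProd f :=
  Adjunction.ofIsLeftAdjoint (Over.pullback f)

variable [HasInitial C]

/-- The domain `B \ im f` of the negation of `f : E ⟶ B`. -/
noncomputable def negObj {E B : C} (f : E ⟶ B) : C :=
  ((depProd f).obj (Over.mk (initial.to E))).left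

/-- The negation `¬ f : B \ im f ⟶ B` of `f : E ⟶ B`: the dependent product along `f` of the
unique map `0 ⟶ E`. -/
noncomputable def neg {E B : C} (f : E ⟶ B) : negObj f ⟶ B :=
  ((depProd f).obj (Over.mk (initial.to E))).hom

variable [HasBinaryCoproducts C]

/-- The map `A + ¬A ⟶ X` induced by a monomorphism `A ⟶ X` and its negation. -/
noncomputable def decidabilityMap {A X : C} (m : A ⟶ X) [Mono m] : A ⨿ negObj m ⟶ X :=
  coprod.desc m (neg m)

/-- A monomorphism is decidable if its decidability map is invertible. -/
def IsDecidable {A X : C} (m : A ⟶ X) [Mono m] : Prop :=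
  IsIso (decidabilityMap m)

end Negation

/-- A polynomial `1 ← E ⟶ B ⟶ 1`. The two outer maps are the unique maps to the terminal object
and are therefore not recorded. -/
structure Poly (C : Type u) [Category.{v} C] where
  /-- the object of inputs -/
  E : C
  /-- the object of positions -/
  B : C
  /-- the middle map -/
  map : E ⟶ B

namespace Poly

/-- A cartesian map of polynomials `1 ← E ⟶ B ⟶ 1`: a pullback square
```
  p.E ---> q.E
   |        |
  p.B ---> q.B
```
Compatibility with the maps to the terminal object is automatic. -/
@[ext]
structure Hom (p q : Poly C) where
  /-- the top map -/
  onE : p.E ⟶ q.E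
  /-- the bottom map -/
  onB : p.B ⟶ q.B
  isPullback : IsPullback onE p.map q.map onB

/-- The category of polynomials `1 ← E ⟶ B ⟶ 1` and cartesian maps. -/
instance : Category (Poly C) where
  Hom p q := Hom p q
  id p := ⟨𝟙 _, 𝟙 _, IsPullback.of_horiz_isIso ⟨by simp⟩⟩
  comp f g := ⟨f.onE ≫ g.onE, f.onB ≫ g.onB, f.isPullback.paste_horiz g.isPullback⟩

@[ext]
lemma hom_ext {p q : Poly C} {f g : p ⟶ q} (hE : f.onE = g.onE) (hB : f.onB = g.onB) : f = g :=
  Hom.ext hE hB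

@[simp] lemma id_onE (p : Poly C) : Hom.onE (𝟙 p) = 𝟙 p.E := rfl
@[simp] lemma id_onB (p : Poly C) : Hom.onB (𝟙 p) = 𝟙 p.B := rfl
@[simp] lemma comp_onE {p q r : Poly C} (f : p ⟶ q) (g : q ⟶ r) :
    Hom.onE (f ≫ g) = f.onE ≫ g.onE := rfl
@[simp] lemma comp_onB {p q r : Poly C} (f : p ⟶ q) (g : q ⟶ r) :
    Hom.onB (f ≫ g) = f.onB ≫ g.onB := rfl

end Poly

section CoprodPullback

variable [HasPullbacks C] [HasBinaryCoproducts C] [IsLocallyCartesianClosed C]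

/-- Binary coproducts are stable under pullback in a locally cartesian closed category. -/
lemma isPullback_coprodMap_desc {X Y A B A' B' : C} {g : X ⟶ Y}
    {a : A ⟶ A'} {f : A ⟶ X} {f' : A' ⟶ Y} {b : B ⟶ B'} {k : B ⟶ X} {k' : B' ⟶ Y}
    (h₁ : IsPullback a f f' g) (h₂ : IsPullback b k k' g) :
    IsPullback (coprod.map a b) (coprod.desc f k) (coprod.desc f' k') g := by
  let inl : Over.mk f' ⟶ Over.mk (coprod.desc f' k') :=
    Over.homMk coprod.inl (coprod.inl_desc _ _)
  let inr : Over.mk k' ⟶ Over.mk (coprod.desc f' k') :=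
    Over.homMk coprod.inr (coprod.inr_desc _ _)
  have hc : IsColimit (BinaryCofan.mk inl inr) :=
    BinaryCofan.isColimitMk
      (fun s => Over.homMk (coprod.desc s.inl.left s.inr.left) (by
        have h₁ : s.inl.left ≫ s.pt.hom = f' := Over.w s.inl
        have h₂ : s.inr.left ≫ s.pt.hom = k' := Over.w s.inr
        apply coprod.hom_ext
        · exact (coprod.inl_desc_assoc _ _ _).trans (h₁.trans (coprod.inl_desc _ _).symm)
        · exact (coprod.inr_desc_assoc _ _ _).trans (h₂.trans (coprod.inr_desc _ _).symm)))
      (fun s => by ext; exact coprod.inl_desc (X := A') (Y := B') _ _)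
      (fun s => by ext; exact coprod.inr_desc (X := A') (Y := B') _ _)
      (fun s m h₁ h₂ => by
        ext
        apply coprod.hom_ext
        · have e : (coprod.inl : _ ⟶ A' ⨿ B') ≫ m.left = s.inl.left := congrArg (fun t => t.left) h₁
          exact e.trans (coprod.inl_desc (X := A') (Y := B') s.inl.left s.inr.left).symm
        · have e : (coprod.inr : _ ⟶ A' ⨿ B') ≫ m.left = s.inr.left := congrArg (fun t => t.left) h₂
          exact e.trans (coprod.inr_desc (X := A') (Y := B') s.inl.left s.inr.left).symm)
  let x : pullback f' g ⟶ pullback (coprod.desc f' k') g :=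
    ((Over.pullback g).map inl).left
  let y : pullback k' g ⟶ pullback (coprod.desc f' k') g :=
    ((Over.pullback g).map inr).left
  have hx₁ : x ≫ pullback.fst _ _ = pullback.fst _ _ ≫ coprod.inl :=
    pullback.lift_fst _ _ _
  have hx₂ : x ≫ pullback.snd _ _ = pullback.snd _ _ :=
    pullback.lift_snd _ _ _
  have hy₁ : y ≫ pullback.fst _ _ = pullback.fst _ _ ≫ coprod.inr :=
    pullback.lift_fst _ _ _
  have hy₂ : y ≫ pullback.snd _ _ = pullback.snd _ _ :=
    pullback.lift_snd _ _ _
  have hd : IsColimit (BinaryCofan.mk x y) :=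
    mapIsColimitOfPreservesOfIsColimit (Over.pullback g ⋙ Over.forget X) inl inr hc
  let z : pullback (coprod.desc f' k') g ⟶ A ⨿ B :=
    hd.desc (BinaryCofan.mk (h₁.isoPullback.inv ≫ coprod.inl) (h₂.isoPullback.inv ≫ coprod.inr))
  have hxz : x ≫ z = h₁.isoPullback.inv ≫ coprod.inl := hd.fac _ ⟨WalkingPair.left⟩
  have hyz : y ≫ z = h₂.isoPullback.inv ≫ coprod.inr := hd.fac _ ⟨WalkingPair.right⟩
  let e : A ⨿ B ≅ pullback (coprod.desc f' k') g :=
    { hom := coprod.desc (h₁.isoPullback.hom ≫ x) (h₂.isoPullback.hom ≫ y)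
      inv := z
      hom_inv_id := by
        apply coprod.hom_ext
        · rw [coprod.inl_desc_assoc, Category.assoc, hxz]; simp
        · rw [coprod.inr_desc_assoc, Category.assoc, hyz]; simp
      inv_hom_id := by
        apply BinaryCofan.IsColimit.hom_ext hd
        · change x ≫ z ≫ _ = x ≫ 𝟙 _
          rw [reassoc_of% hxz, coprod.inl_desc]; simp
        · change y ≫ z ≫ _ = y ≫ 𝟙 _
          rw [reassoc_of% hyz, coprod.inr_desc]; simp }
  have hl : coprod.inl ≫ e.hom = h₁.isoPullback.hom ≫ x := coprod.inl_desc _ _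
  have hr : coprod.inr ≫ e.hom = h₂.isoPullback.hom ≫ y := coprod.inr_desc _ _
  have H₁ : e.hom ≫ pullback.fst _ _ = coprod.map a b := by
    apply coprod.hom_ext
    · rw [reassoc_of% hl, hx₁]; simp
    · rw [reassoc_of% hr, hy₁]; simp
  have H₂ : e.hom ≫ pullback.snd _ _ = coprod.desc f k := by
    apply coprod.hom_ext
    · rw [reassoc_of% hl, hx₂]; simp [coprod.inl_desc]
    · rw [reassoc_of% hr, hy₂]; simp [coprod.inr_desc]
  exact IsPullback.of_iso (IsPullback.of_hasPullback (coprod.desc f' k') g) e.symm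
    (Iso.refl _) (Iso.refl _) (Iso.refl _) (by simp [← H₁]) (by simp [← H₂]) (by simp) (by simp)

end CoprodPullback

section Product

set_option linter.unusedSimpArgs false

/-- Pullback squares are stable under taking the product with a fixed object. -/
lemma isPullback_prodMap_id [HasFiniteLimits C] {P X Y Z : C} {a : P ⟶ X} {b : P ⟶ Y}
    {c : X ⟶ Z} {d : Y ⟶ Z} (h : IsPullback a b c d) (W : C) :
    IsPullback (prod.map a (𝟙 W)) (prod.map b (𝟙 W)) (prod.map c (𝟙 W)) (prod.map d (𝟙 W)) := by
  refine ⟨⟨by simp [h.w]⟩, ⟨PullbackCone.IsLimit.mk _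
    (fun s => prod.lift (h.lift (s.fst ≫ prod.fst) (s.snd ≫ prod.fst) ?_) (s.fst ≫ prod.snd))
    ?_ ?_ ?_⟩⟩
  · simpa [prod.lift_fst, prod.lift_snd, prod.lift_fst_assoc, prod.lift_snd_assoc]
        using s.condition =≫ prod.fst
  · intro s
    apply Limits.prod.hom_ext <;> simp [prod.lift_fst, prod.lift_snd, prod.lift_fst_assoc, prod.lift_snd_assoc]
  · intro s
    apply Limits.prod.hom_ext
    · simp [prod.lift_fst, prod.lift_snd, prod.lift_fst_assoc, prod.lift_snd_assoc]
    · simpa [prod.lift_fst, prod.lift_snd, prod.lift_fst_assoc, prod.lift_snd_assoc]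
        using s.condition =≫ prod.snd
  · intro s m h₁ h₂
    apply Limits.prod.hom_ext
    · apply h.hom_ext
      · simpa [prod.lift_fst, prod.lift_snd, prod.lift_fst_assoc, prod.lift_snd_assoc]
        using h₁ =≫ prod.fst
      · simpa [prod.lift_fst, prod.lift_snd, prod.lift_fst_assoc, prod.lift_snd_assoc]
        using h₂ =≫ prod.fst
    · simpa [prod.lift_fst, prod.lift_snd, prod.lift_fst_assoc, prod.lift_snd_assoc]
        using h₁ =≫ prod.snd

/-- For `e : E ⟶ B` and `f : X ⟶ Y`, the map `E × X ⟶ X × B` is the pullback of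
`E × Y ⟶ Y × B` along `f × B`. -/
lemma isPullback_prodLift_snd [HasFiniteLimits C] {E B X Y : C} (e : E ⟶ B) (f : X ⟶ Y) :
    IsPullback (prod.map (𝟙 E) f) (prod.lift prod.snd (prod.fst ≫ e))
      (prod.lift prod.snd (prod.fst ≫ e)) (prod.map f (𝟙 B)) := by
  refine ⟨⟨by apply Limits.prod.hom_ext <;> simp [prod.lift_fst, prod.lift_snd, prod.lift_fst_assoc, prod.lift_snd_assoc]⟩, ⟨PullbackCone.IsLimit.mk _
    (fun s => prod.lift (s.fst ≫ prod.fst) (s.snd ≫ prod.fst)) ?_ ?_ ?_⟩⟩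
  · intro s
    apply Limits.prod.hom_ext
    · simp [prod.lift_fst, prod.lift_snd, prod.lift_fst_assoc, prod.lift_snd_assoc]
    · simpa [prod.lift_fst, prod.lift_snd, prod.lift_fst_assoc, prod.lift_snd_assoc]
        using (s.condition =≫ prod.fst).symm
  · intro s
    apply Limits.prod.hom_ext
    · simp [prod.lift_fst, prod.lift_snd, prod.lift_fst_assoc, prod.lift_snd_assoc]
    · simpa [prod.lift_fst, prod.lift_snd, prod.lift_fst_assoc, prod.lift_snd_assoc]
        using s.condition =≫ prod.snd
  · intro s m h₁ h₂
    apply Limits.prod.hom_ext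
    · simpa [prod.lift_fst, prod.lift_snd, prod.lift_fst_assoc, prod.lift_snd_assoc]
        using h₁ =≫ prod.fst
    · simpa [prod.lift_fst, prod.lift_snd, prod.lift_fst_assoc, prod.lift_snd_assoc]
        using h₂ =≫ prod.fst

variable [HasFiniteLimits C] [HasBinaryCoproducts C]

/-- The product `p ∗ q` of polynomials: `E × B' + E' × B ⟶ B × B'`. -/
noncomputable def mul (p q : Poly C) : Poly C where
  E := (p.E ⨯ q.B) ⨿ (q.E ⨯ p.B)
  B := p.B ⨯ q.B
  map := coprod.desc (prod.map p.map (𝟙 q.B)) (prod.lift prod.snd (prod.fst ≫ q.map))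

variable [IsLocallyCartesianClosed C]

/-- The functor `(-) ∗ q` on polynomials and cartesian maps. -/
noncomputable def mulFunctor (q : Poly C) : Poly C ⥤ Poly C where
  obj p := mul p q
  map {p p'} f :=
    { onE := coprod.map (prod.map f.onE (𝟙 q.B)) (prod.map (𝟙 q.E) f.onB)
      onB := prod.map f.onB (𝟙 q.B)
      isPullback := isPullback_coprodMap_desc
        (isPullback_prodMap_id f.isPullback q.B)
        (isPullback_prodLift_snd q.map f.onB) }
  map_id p := by ext <;> simp [mul]
  map_comp f g := by ext <;> simp [mul]

variable (C) in
/-- The linear polynomial `1 ← 1 ⟶ 1 ⟶ 1`, whose polynomial functor is `X ↦ X`. -/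
noncomputable def linear : Poly C where
  E := ⊤_ C
  B := ⊤_ C
  map := 𝟙 _

variable (C) in
/-- Multiplication `(-) ∗ 1` by the linear polynomial. -/
noncomputable def linearMul : Poly C ⥤ Poly C := mulFunctor (linear C)

/-- The derivative of `p` exists: the right adjoint to `(-) ∗ 1` is defined at `p`, that is,
the presheaf `q ↦ (q ∗ 1 ⟶ p)` on polynomials is representable. -/
def HasDerivative (p : Poly C) : Prop := (linearMul C).rightAdjointObjIsDefined p

/-- The derivative `D p`: the value at `p` of the (partially defined) right adjoint to
`(-) ∗ 1`. -/
noncomputable def derivative (p : Poly C) (h : HasDerivative p) : Poly C :=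
  (linearMul C).partialRightAdjoint.obj ⟨p, h⟩

end Product

section Candidate

variable [HasPullbacks C] [IsLocallyCartesianClosed C] [HasInitial C]

/-- The polynomial `E ⊠_B E ⟶ E ×_B E ⟶ E` given by the negation of the diagonal followed by the
first projection. -/
noncomputable def distinctPairs (p : Poly C) : Poly C where
  E := negObj (pullback.diagonal p.map)
  B := p.E
  map := neg (pullback.diagonal p.map) ≫ pullback.fst p.map p.map

end Candidate

end PolyDeriv

/-! Since `q ∗ 1` is `(q, id) : q.E + q.B ⟶ q.B`, a cartesian map `q ∗ 1 ⟶ p` amounts to a choice `s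
: q.B ⟶ E` and a map `e : q.E ⟶ E` exhibiting the fibre of `p` through `s b` as the fibre of `q` at
`b` plus the point `s b`. The universal `s` is the identity of `E`: decidability of the diagonal
splits `E ×_B E ⟶ E` into the distinct pairs and the diagonal, which is the counit
(`isPullback_distinctPairs`).

For general `(e, s)`, the pair `(s ∘ q, e) : q.E ⟶ E ×_B E` misses the diagonal because sums are
disjoint, so it factors through `¬δ`. Pasting and extensivity make the factorisation cartesian
(`exists_isPullback_distinctPairs`), and it is unique because negations are monic (`mono_neg`). -/

namespace PolyDeriv

attribute [local simp] coprod.inl_desc coprod.inr_desc coprod.inl_desc_assoc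
  coprod.inr_desc_assoc
  prod.lift_fst prod.lift_snd prod.lift_fst_assoc prod.lift_snd_assoc

/-! ### Strict initial object and extensivity -/

section Extensivity

variable {C : Type u} [Category.{v} C] [HasFiniteLimits C] [IsLocallyCartesianClosed C]

/-- The identity of `I` is initial in `Over I`. Pullback along `f` and the forgetful functor are
left adjoints, so they preserve this, and the pullback of `𝟙 I` along `f` is `A`. -/
lemma hasStrictInitialObjects : HasStrictInitialObjects C where
  out {I A} f hI := by
    have hO : IsInitial (Over.mk (𝟙 I)) :=
      IsInitial.ofUniqueHom (fun X => Over.homMk (hI.to X.left) (hI.hom_ext _ _))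
        (fun X m => by ext; exact hI.hom_ext _ _)
    have : PreservesColimitsOfSize.{0, 0} (Over.pullback f) :=
      (Adjunction.ofIsLeftAdjoint (Over.pullback f)).leftAdjoint_preservesColimits
    have : PreservesColimitsOfSize.{0, 0} (Over.forget A) :=
      (Over.forgetAdjStar A).leftAdjoint_preservesColimits
    have hP : IsInitial (pullback (𝟙 I) f) :=
      (hO.isInitialObj (Over.pullback f)).isInitialObj (Over.forget A)
    have hA : IsInitial A := hP.ofIso (asIso (pullback.snd (𝟙 I) f))
    exact ⟨hI.to A, hA.hom_ext _ _, hI.hom_ext _ _⟩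

/-- A commutative square over a disjoint binary coproduct has an initial vertex. -/
lemma nonempty_isInitial_of_inl_eq_inr [HasBinaryCoproducts C] [BinaryCoproductsDisjoint C]
    {T X Y : C} (a : T ⟶ X) (b : T ⟶ Y)
    (h : a ≫ (coprod.inl : X ⟶ X ⨿ Y) = b ≫ coprod.inr) : Nonempty (IsInitial T) := by
  have : HasStrictInitialObjects C := hasStrictInitialObjects
  have : BinaryCoproductDisjoint X Y := CoproductsOfShapeDisjoint.coproductDisjoint _
  exact ⟨IsInitial.ofStrict (pullback.lift a b h) IsInitial.ofBinaryCoproductDisjoint⟩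

/-- In a disjoint and universal coproduct, `A` is the part of `A ⨿ B` lying over `A'`. -/
lemma isPullback_inl_coprodMap [HasInitial C] [HasBinaryCoproducts C]
    [BinaryCoproductsDisjoint C] {A A' B B' : C} (f : A ⟶ A') (g : B ⟶ B') :
    IsPullback coprod.inl f (coprod.map f g) coprod.inl := by
  have : BinaryCoproductDisjoint A' B' := CoproductsOfShapeDisjoint.coproductDisjoint _
  -- Pull `inl` back along each summand: monicity of `inl` gives `A`, disjointness gives the initial
  -- object. Stability of sums combines them into `A + 0 ≅ A`.
  have h₁ : IsPullback (𝟙 A) f (f ≫ coprod.inl) (coprod.inl : A' ⟶ A' ⨿ B') :=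
    ⟨⟨by simp⟩, ⟨PullbackCone.IsLimit.mk _ (fun s => s.fst) (fun s => by simp)
      (fun s => by rw [← cancel_mono (coprod.inl : A' ⟶ A' ⨿ B')]; simpa using s.condition)
      (fun s m h _ => by simpa using h)⟩⟩
  have h₂ : IsPullback (initial.to B) (initial.to A') (g ≫ coprod.inr)
      (coprod.inl : A' ⟶ A' ⨿ B') := by
    have hs (s : PullbackCone (g ≫ coprod.inr) (coprod.inl : A' ⟶ A' ⨿ B')) : IsInitial s.pt :=
      (nonempty_isInitial_of_inl_eq_inr s.snd (s.fst ≫ g) (by simpa using s.condition.symm)).some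
    exact ⟨⟨initialIsInitial.hom_ext _ _⟩, ⟨PullbackCone.IsLimit.mk _ (fun s => (hs s).to _)
      (fun s => (hs s).hom_ext _ _) (fun s => (hs s).hom_ext _ _)
      (fun s m _ _ => (hs s).hom_ext _ _)⟩⟩
  let i : A ≅ A ⨿ ⊥_ C :=
    { hom := coprod.inl
      inv := coprod.desc (𝟙 A) (initial.to A)
      hom_inv_id := by simp
      inv_hom_id := by ext; simp }
  refine (isPullback_coprodMap_desc h₁ h₂).of_iso i.symm (Iso.refl _) (Iso.refl _) (Iso.refl _)
    ?_ ?_ ?_ ?_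
  · apply coprod.hom_ext
    · simp [i]
    · exact initialIsInitial.hom_ext _ _
  · apply coprod.hom_ext
    · simp [i]
    · exact initialIsInitial.hom_ext _ _
  · apply coprod.hom_ext <;> simp
  · simp

end Extensivity

/-! ### Universal property of the negation -/

section Negation

variable {C : Type u} [Category.{v} C] [HasFiniteLimits C] [IsLocallyCartesianClosed C]
  [HasInitial C]

/-- Maps over `B` into the negation of `f` correspond to maps over `E` into the initial object. -/
noncomputable def negHomEquiv {E B X : C} (f : E ⟶ B) (x : X ⟶ B) :
    ((Over.pullback f).obj (Over.mk x) ⟶ Over.mk (initial.to E)) ≃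
      (Over.mk x ⟶ (depProd f).obj (Over.mk (initial.to E))) :=
  (depProdAdj f).homEquiv _ _

/-- Maps into `¬ f` over `B` transpose to maps into `0` over `E`; by strictness their domain is
initial, so any two agree. -/
instance mono_neg {E B : C} (f : E ⟶ B) : Mono (neg f) where
  right_cancellation {Z} g h w := by
    have : HasStrictInitialObjects C := hasStrictInitialObjects
    let g' : Over.mk (g ≫ neg f) ⟶ (depProd f).obj (Over.mk (initial.to E)) := Over.homMk g rfl
    let h' : Over.mk (g ≫ neg f) ⟶ (depProd f).obj (Over.mk (initial.to E)) :=
      Over.homMk h w.symm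
    have key : g' = h' := by
      apply (negHomEquiv f _).symm.injective
      ext
      exact (IsInitial.ofStrict ((negHomEquiv f _).symm g').left initialIsInitial).hom_ext _ _
    exact congrArg (fun t => t.left) key

/-- A map which meets `f` only in the initial object factors through the negation of `f`. -/
lemma exists_comp_neg_eq {E B X : C} (f : E ⟶ B) (x : X ⟶ B)
    (h : IsInitial (pullback x f)) : ∃ w : X ⟶ negObj f, w ≫ neg f = x := by
  let k : (Over.pullback f).obj (Over.mk x) ⟶ Over.mk (initial.to E) :=
    Over.homMk (h.to _) (h.hom_ext _ _)
  exact ⟨(negHomEquiv f x k).left, Over.w (negHomEquiv f x k)⟩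

end Negation

/-! ### Cartesian maps out of `q ∗ 1` -/

section LinearMul

variable {C : Type u} [Category.{v} C] [HasFiniteLimits C] [HasBinaryCoproducts C]
  [IsLocallyCartesianClosed C]

/-- The object of inputs of `q ∗ 1`. -/
noncomputable def linearMulIsoE (q : Poly C) : q.E ⨿ q.B ≅ ((linearMul C).obj q).E :=
  coprod.mapIso (prod.rightUnitor q.E).symm (prod.leftUnitor q.B).symm

/-- The object of positions of `q ∗ 1`. -/
noncomputable def linearMulIsoB (q : Poly C) : q.B ≅ ((linearMul C).obj q).B :=
  (prod.rightUnitor q.B).symm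

lemma linearMulIsoE_hom_map (q : Poly C) :
    (linearMulIsoE q).hom ≫ ((linearMul C).obj q).map =
      coprod.desc q.map (𝟙 _) ≫ (linearMulIsoB q).hom := by
  change coprod.map (prod.rightUnitor q.E).inv (prod.leftUnitor q.B).inv ≫
    coprod.desc (prod.map q.map (𝟙 (⊤_ C))) (prod.lift prod.snd (prod.fst ≫ 𝟙 (⊤_ C))) =
      coprod.desc q.map (𝟙 _) ≫ (prod.rightUnitor q.B).inv
  rw [← cancel_mono (prod.rightUnitor q.B).hom]
  apply coprod.hom_ext <;> simp

lemma linearMulIsoE_hom_map_onE {q r : Poly C} (g : q ⟶ r) :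
    (linearMulIsoE q).hom ≫ ((linearMul C).map g).onE =
      coprod.map g.onE g.onB ≫ (linearMulIsoE r).hom := by
  change coprod.map (prod.rightUnitor q.E).inv (prod.leftUnitor q.B).inv ≫
    coprod.map (prod.map g.onE (𝟙 (⊤_ C))) (prod.map (𝟙 (⊤_ C)) g.onB) =
      coprod.map g.onE g.onB ≫ coprod.map (prod.rightUnitor r.E).inv (prod.leftUnitor r.B).inv
  simp only [coprod.map_map]
  congr 1
  · rw [← cancel_mono (prod.rightUnitor r.E).hom]; simp
  · rw [← cancel_mono (prod.leftUnitor r.B).hom]; simp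

/-- A cartesian map `q ∗ 1 ⟶ p` from a pullback square with left-hand side
`(q, id) : q.E + q.B ⟶ q.B`. -/
noncomputable def linearMulHomMk {q p : Poly C} (e : q.E ⟶ p.E) (s : q.B ⟶ p.E) {b : q.B ⟶ p.B}
    (h : IsPullback (coprod.desc e s) (coprod.desc q.map (𝟙 _)) p.map b) :
    (linearMul C).obj q ⟶ p where
  onE := (linearMulIsoE q).inv ≫ coprod.desc e s
  onB := (linearMulIsoB q).inv ≫ b
  isPullback := h.of_iso (linearMulIsoE q) (Iso.refl _) (linearMulIsoB q) (Iso.refl _)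
    (by simp) (linearMulIsoE_hom_map q).symm (by simp) (by simp)

/-- On the summand `q.B` the polynomial `q ∗ 1` is the identity, so the bottom map is determined by
the top one. -/
lemma linearMulIsoB_hom_onB {q p : Poly C} (f : (linearMul C).obj q ⟶ p) :
    (linearMulIsoB q).hom ≫ f.onB = (coprod.inr ≫ (linearMulIsoE q).hom ≫ f.onE) ≫ p.map := by
  simp only [Category.assoc]
  rw [f.isPullback.w, reassoc_of% linearMulIsoE_hom_map q, coprod.inr_desc_assoc,
    Category.id_comp]

lemma linearMul_hom_ext {q p : Poly C} {f f' : (linearMul C).obj q ⟶ p}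
    (h : (linearMulIsoE q).hom ≫ f.onE = (linearMulIsoE q).hom ≫ f'.onE) : f = f' := by
  apply Poly.hom_ext
  · exact (cancel_epi _).1 h
  · rw [← cancel_epi (linearMulIsoB q).hom, linearMulIsoB_hom_onB, linearMulIsoB_hom_onB, h]

lemma isPullback_of_linearMul_hom {q p : Poly C} (f : (linearMul C).obj q ⟶ p) :
    IsPullback ((linearMulIsoE q).hom ≫ f.onE) (coprod.desc q.map (𝟙 _)) p.map
      ((linearMulIsoB q).hom ≫ f.onB) :=
  f.isPullback.of_iso (linearMulIsoE q).symm (Iso.refl _) (linearMulIsoB q).symm (Iso.refl _)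
    (by simp)
    (by simp only [Iso.symm_hom]
        rw [Iso.eq_inv_comp, reassoc_of% linearMulIsoE_hom_map q, Iso.hom_inv_id,
          Category.comp_id])
    (by simp) (by simp)

end LinearMul

/-! ### The counit and its universal property -/

section Derivative

variable {C : Type u} [Category.{v} C] [HasFiniteLimits C] [IsLocallyCartesianClosed C]
  [HasFiniteCoproducts C] {p : Poly C}

/-- If the diagonal of `p` is decidable, then `E ×_B E` is the sum of `E ⊠_B E` and `E`. -/
lemma isPullback_distinctPairs (hp : IsDecidable (pullback.diagonal p.map)) :
    IsPullback
      (coprod.desc (neg (pullback.diagonal p.map) ≫ pullback.snd p.map p.map) (𝟙 p.E))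
      (coprod.desc (neg (pullback.diagonal p.map) ≫ pullback.fst p.map p.map) (𝟙 p.E))
      p.map p.map := by
  have : IsIso (decidabilityMap (pullback.diagonal p.map)) := hp
  -- Decidability lists the diagonal first, whereas `(-) ∗ 1` has the linear summand last.
  let i := coprod.braiding (negObj (pullback.diagonal p.map)) p.E ≪≫
    asIso (decidabilityMap (pullback.diagonal p.map))
  have hi : i.hom = coprod.desc (neg (pullback.diagonal p.map)) (pullback.diagonal p.map) := by
    apply coprod.hom_ext <;> simp [i, decidabilityMap]
  refine (IsPullback.of_hasPullback p.map p.map).flip.of_iso i.symm (Iso.refl _) (Iso.refl _)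
    (Iso.refl _) ?_ ?_ ((Category.comp_id _).trans (Category.id_comp _).symm)
    ((Category.comp_id _).trans (Category.id_comp _).symm)
  · rw [Iso.symm_hom, Iso.eq_inv_comp, hi]
    apply coprod.hom_ext <;> simp
  · rw [Iso.symm_hom, Iso.eq_inv_comp, hi]
    apply coprod.hom_ext <;> simp

/-- The counit `D p ∗ 1 ⟶ p`. -/
noncomputable def distinctPairsCounit (hp : IsDecidable (pullback.diagonal p.map)) :
    (linearMul C).obj (distinctPairs p) ⟶ p :=
  linearMulHomMk (q := distinctPairs p)
    (neg (pullback.diagonal p.map) ≫ pullback.snd p.map p.map) (𝟙 p.E)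
    (isPullback_distinctPairs hp)

lemma linearMulIsoE_hom_map_counit (hp : IsDecidable (pullback.diagonal p.map)) {q : Poly C}
    (g : q ⟶ distinctPairs p) :
    (linearMulIsoE q).hom ≫ ((linearMul C).map g ≫ distinctPairsCounit hp).onE =
      coprod.desc (g.onE ≫ neg (pullback.diagonal p.map) ≫ pullback.snd p.map p.map) g.onB := by
  rw [Poly.comp_onE, reassoc_of% linearMulIsoE_hom_map_onE g]
  simp only [distinctPairsCounit, linearMulHomMk, Iso.hom_inv_id_assoc]
  apply coprod.hom_ext
  · exact (coprod.inl_map_assoc _ _ _).trans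
      ((congrArg (g.onE ≫ ·) (coprod.inl_desc _ _)).trans (coprod.inl_desc _ _).symm)
  · exact (coprod.inr_map_assoc _ _ _).trans
      ((congrArg (g.onB ≫ ·) (coprod.inr_desc _ _)).trans
        ((Category.comp_id _).trans (coprod.inr_desc _ _).symm))

/-- The summand `q.B` recovers `g.onB`. In `E ×_B E`, the first coordinate of `g.onE` is then fixed
by the square of `g`, the second by the summand `q.E`. -/
lemma injective_map_comp_counit (hp : IsDecidable (pullback.diagonal p.map)) (q : Poly C) :
    Function.Injective
      (fun g : q ⟶ distinctPairs p => (linearMul C).map g ≫ distinctPairsCounit hp) := by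
  intro g g' h
  have h' : (linearMulIsoE q).hom ≫ ((linearMul C).map g ≫ distinctPairsCounit hp).onE =
      (linearMulIsoE q).hom ≫ ((linearMul C).map g' ≫ distinctPairsCounit hp).onE :=
    congrArg (fun t => (linearMulIsoE q).hom ≫ Poly.Hom.onE t) h
  rw [linearMulIsoE_hom_map_counit, linearMulIsoE_hom_map_counit] at h'
  have hB : g.onB = g'.onB := (coprod.inr_desc _ _).symm.trans ((coprod.inr ≫= h').trans (coprod.inr_desc _ _))
  have hE := (coprod.inl_desc _ _).symm.trans ((coprod.inl ≫= h').trans (coprod.inl_desc _ _))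
  refine Poly.hom_ext ?_ hB
  apply (cancel_mono (neg (pullback.diagonal p.map))).1
  apply pullback.hom_ext
  · have w := g.isPullback.w
    have w' := g'.isPullback.w
    rw [hB, ← w'] at w
    exact (Category.assoc _ _ _).trans (w.trans (Category.assoc _ _ _).symm)
  · exact (Category.assoc _ _ _).trans (hE.trans (Category.assoc _ _ _).symm)

variable [BinaryCoproductsDisjoint C]

/-- A pullback square from `(q, id) : q.E + q.B ⟶ q.B` to `p` restricts to a pullback square from
`q` to the pairs of distinct inputs. -/
lemma exists_isPullback_distinctPairs (hp : IsDecidable (pullback.diagonal p.map)) {q : Poly C}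
    (e : q.E ⟶ p.E) (s : q.B ⟶ p.E)
    (h : IsPullback (coprod.desc e s) (coprod.desc q.map (𝟙 _)) p.map (s ≫ p.map)) :
    ∃ w : q.E ⟶ negObj (pullback.diagonal p.map),
      w ≫ neg (pullback.diagonal p.map) ≫ pullback.snd p.map p.map = e ∧
      IsPullback w q.map (neg (pullback.diagonal p.map) ≫ pullback.fst p.map p.map) s := by
  have he : (q.map ≫ s) ≫ p.map = e ≫ p.map := by
    simpa using (coprod.inl ≫= h.w).symm
  let t : q.E ⟶ pullback p.map p.map := pullback.lift (q.map ≫ s) e he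
  have ht₁ : t ≫ pullback.fst _ _ = q.map ≫ s := pullback.lift_fst _ _ _
  have ht₂ : t ≫ pullback.snd _ _ = e := pullback.lift_snd _ _ _
  -- Where `t` meets the diagonal, `e = s ∘ q`. There `inl` and `inr ∘ q` have equal images in `E`
  -- and in `q.B`, hence agree in the pullback `q.E + q.B`.
  have hinit : Nonempty (IsInitial (pullback t (pullback.diagonal p.map))) := by
    refine nonempty_isInitial_of_inl_eq_inr (pullback.fst _ _) (pullback.fst _ _ ≫ q.map) ?_
    have c := pullback.condition (f := t) (g := pullback.diagonal p.map)
    have c₁ := c =≫ pullback.fst _ _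
    have c₂ := c =≫ pullback.snd _ _
    simp only [Category.assoc, ht₁, ht₂, pullback.diagonal_fst, pullback.diagonal_snd,
      Category.comp_id] at c₁ c₂
    apply h.hom_ext
    · simp [c₁, c₂]
    · simp
  obtain ⟨w, hw⟩ := exists_comp_neg_eq (pullback.diagonal p.map) t hinit.some
  have hw₁ : w ≫ neg (pullback.diagonal p.map) ≫ pullback.fst p.map p.map = q.map ≫ s := by
    rw [← ht₁, ← hw, Category.assoc]
  have hw₂ : w ≫ neg (pullback.diagonal p.map) ≫ pullback.snd p.map p.map = e := by
    rw [← ht₂, ← hw, Category.assoc]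
  refine ⟨w, hw₂, ?_⟩
  -- Pasted with the universal square, this square gives `h`.
  have hleft : IsPullback (coprod.map w s) (coprod.desc q.map (𝟙 _))
      (coprod.desc (neg (pullback.diagonal p.map) ≫ pullback.fst p.map p.map) (𝟙 p.E)) s := by
    refine IsPullback.of_right ?_ ?_ (isPullback_distinctPairs hp)
    · convert! h using 1
      apply coprod.hom_ext
      · rw [coprod.inl_map_assoc, coprod.inl_desc, coprod.inl_desc, hw₂]
      · rw [coprod.inr_map_assoc, coprod.inr_desc, coprod.inr_desc, Category.comp_id]
    · apply coprod.hom_ext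
      · rw [coprod.inl_map_assoc, coprod.inl_desc, coprod.inl_desc_assoc, hw₁]
      · rw [coprod.inr_map_assoc, coprod.inr_desc, coprod.inr_desc_assoc, Category.comp_id,
          Category.id_comp]
  -- Extensivity restricts the square to the first summands.
  simpa using (isPullback_inl_coprodMap w s).flip.paste_vert hleft

lemma surjective_map_comp_counit (hp : IsDecidable (pullback.diagonal p.map)) (q : Poly C) :
    Function.Surjective
      (fun g : q ⟶ distinctPairs p => (linearMul C).map g ≫ distinctPairsCounit hp) := by
  intro f
  let e : q.E ⟶ p.E := coprod.inl ≫ (linearMulIsoE q).hom ≫ f.onE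
  let s : q.B ⟶ p.E := coprod.inr ≫ (linearMulIsoE q).hom ≫ f.onE
  have hes : (linearMulIsoE q).hom ≫ f.onE = coprod.desc e s := by
    apply coprod.hom_ext <;> simp [e, s]
  have h := isPullback_of_linearMul_hom f
  rw [hes, linearMulIsoB_hom_onB f] at h
  obtain ⟨w, hw, hpb⟩ := exists_isPullback_distinctPairs hp e s h
  let g : q ⟶ distinctPairs p := ⟨w, s, hpb⟩
  refine ⟨g, linearMul_hom_ext ?_⟩
  rw [linearMulIsoE_hom_map_counit, hes]
  exact congrArg (coprod.desc · s) hw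

/-- The polynomial of pairs of distinct inputs represents `q ↦ (q ∗ 1 ⟶ p)`. -/
noncomputable def distinctPairsRepresentableBy (hp : IsDecidable (pullback.diagonal p.map)) :
    ((linearMul C).op ⋙ yoneda.obj p).RepresentableBy (distinctPairs p) where
  homEquiv {q} := Equiv.ofBijective
    (fun g : q ⟶ distinctPairs p => (linearMul C).map g ≫ distinctPairsCounit hp)
    ⟨injective_map_comp_counit hp q, surjective_map_comp_counit hp q⟩
  homEquiv_comp f g := by
    change (linearMul C).map (f ≫ g) ≫ _ = (linearMul C).map f ≫ (linearMul C).map g ≫ _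
    rw [Functor.map_comp, Category.assoc]

end Derivative

end PolyDeriv

theorem mainTheorem5 {C : Type u} [Category.{v} C] [HasFiniteLimits C]
    [IsLocallyCartesianClosed C] [HasFiniteCoproducts C] [BinaryCoproductsDisjoint C]
    (p : PolyDeriv.Poly C)
    (hp : PolyDeriv.IsDecidable (pullback.diagonal p.map)) :
    ∃ h : PolyDeriv.HasDerivative p,
      Nonempty (PolyDeriv.derivative p h ≅ PolyDeriv.distinctPairs p) := by
  have hr := PolyDeriv.distinctPairsRepresentableBy hp
  have h : PolyDeriv.HasDerivative p := hr.isRepresentable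
  have : (((PolyDeriv.linearMul C).op ⋙ yoneda.obj p)).IsRepresentable := h
  -- `derivative` is the chosen representing object, and representing objects are unique up to
  -- isomorphism.
  exact ⟨h, ⟨(Functor.representableBy _).uniqueUpToIso hr⟩⟩
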